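/- Consider a five-dimensional stationary, bi-axisymmetric vacuum metric in $\sigma$-model form $$ds^2=\sum_{i,j}J_{ij}(r,z)\,dx^i dx^j+e^{2\nu(r,z)}(dr^2+dz^2),\qquad (x^i)=(t,\varphi,\psi),\qquad \det J=-r^2,$$ and put $r=uv$, $z=\tfrac12(v^2-u^2)$ with $u\ge 0$, $v>0$. Let $I\subseteq(0,\infty)$ be an open interval (a segment $\{u=0,\ v\in I\}$ of the axis) and let $\Omega$ be an open subset of $\{(u,v): v>0\}$ containing $\{0\}\times I$. Suppose that, at the points of $\Omega$ with $u>0$, $J$ and $\nu$ are differentiable as functions of $(r,z)$ and the Einstein equation for the conformal factor holds, $$\partial_\xi\log\left(r e^{2\nu}\right)=\frac{\mathrm i r}{2}\,\mathrm{tr}\left(J^{-1}J_\xi J^{-1}J_\xi\right),\qquad \xi=z+\mathrm i r,\quad \partial_\xi=\tfrac12(\partial_z-\mathrm i\,\partial_r),$$ and that there $$J=\begin{pmatrix}X_0&u^2Y_0&v^2Z_0\\ u^2Y_0&u^2U_0&u^2v^2V_0\\ v^2Z_0&u^2v^2V_0&v^2W_0\end{pmatrix},$$ where $X_0,Y_0,Z_0,U_0,V_0,W_0$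 are functions of $(u,v)$ that are $C^1$ on $\Omega\cap\{u\ge0\}$, i.e. up to the axis segment. Then $\nu$ has a limit $\nu(0,v)$ at every point $(0,v)$, $v\in I$, of the segment (as $(u',v')\to(0,v)$ with $u'>0$), and the ratio $$\frac{U_0}{v^2e^{2\nu}}\bigg|_{u=0}$$ is a non-zero constant on $I$. In particular, if the non-conicality condition $U_0/(v^2e^{2\nu})=1$ holds at one point of the segment, then it holds on the whole segment. -/

import Mathlib

open Filter Topology

noncomputable section

/-- The Weyl coordinates `(r, z) = (u v, (v ^ 2 - u ^ 2) / 2)` of the point `p = (u, v)`. -/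
def weylPoint (p : ℝ × ℝ) : ℝ × ℝ := (p.1 * p.2, (p.2 ^ 2 - p.1 ^ 2) / 2)

/-- The Wirtinger derivative `∂_ξ f = (∂_z f - i ∂_r f) / 2`, where `ξ = z + i r`, of a real
function `f` of the Weyl coordinates `q = (r, z)`. -/
def dXi (f : ℝ × ℝ → ℝ) (q : ℝ × ℝ) : ℂ :=
  (((deriv (fun z => f (q.1, z)) q.2 : ℝ) : ℂ)
    - Complex.I * ((deriv (fun r => f (r, q.2)) q.1 : ℝ) : ℂ)) / 2

/-- The entrywise derivative `J_ξ`. -/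
def dXiMatrix (J : ℝ × ℝ → Matrix (Fin 3) (Fin 3) ℝ) (q : ℝ × ℝ) : Matrix (Fin 3) (Fin 3) ℂ :=
  Matrix.of fun i j => dXi (fun q' => J q' i j) q

/-- The part of the Einstein vacuum equations that determines the conformal factor `e ^ (2 ν)` of
the metric `∑ J_ij dx^i dx^j + e ^ (2 ν) (dr ^ 2 + dz ^ 2)`, at the point `q = (r, z)`:
`∂_ξ (log (r e ^ (2 ν))) = (i r / 2) tr (J⁻¹ J_ξ J⁻¹ J_ξ)`. -/
def ConformalFactorEq (J : ℝ × ℝ → Matrix (Fin 3) (Fin 3) ℝ) (ν : ℝ × ℝ → ℝ) (q : ℝ × ℝ) : Prop :=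
  dXi (fun q' => Real.log (q'.1 * Real.exp (2 * ν q'))) q =
    Complex.I * (q.1 : ℂ) / 2 *
      Matrix.trace (((J q).map Complex.ofReal)⁻¹ * dXiMatrix J q *
        ((J q).map Complex.ofReal)⁻¹ * dXiMatrix J q)

/-- The matrix of the Killing part of the metric in the basis `(∂_t, ∂_φ, ∂_ψ)`, at `p = (u, v)`,
near an axis on which `∂_φ` vanishes at `u = 0` and `∂_ψ` vanishes at `v = 0`. -/
def axisMatrix (X₀ Y₀ Z₀ U₀ V₀ W₀ : ℝ × ℝ → ℝ) (p : ℝ × ℝ) : Matrix (Fin 3) (Fin 3) ℝ :=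
  !![X₀ p, p.1 ^ 2 * Y₀ p, p.2 ^ 2 * Z₀ p;
     p.1 ^ 2 * Y₀ p, p.1 ^ 2 * U₀ p, p.1 ^ 2 * p.2 ^ 2 * V₀ p;
     p.2 ^ 2 * Z₀ p, p.1 ^ 2 * p.2 ^ 2 * V₀ p, p.2 ^ 2 * W₀ p]

/-- The ratio `U₀ / (v ^ 2 e ^ (2 ν))` at the point `(0, v)` of the axis, where `ν₀ v` is the
boundary value of `ν` there. There is no conical singularity at that point iff it is `1`. -/
def axisRatio (U₀ : ℝ × ℝ → ℝ) (ν₀ : ℝ → ℝ) (v : ℝ) : ℝ :=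
  U₀ (0, v) / (v ^ 2 * Real.exp (2 * ν₀ v))

end

noncomputable section

/-! With `w = v + i u` one has `ξ = w² / 2`, so `∂_w = w ∂_ξ` and the equation becomes `∂_w log (r
e^(2ν)) = (i u v / 2w) tr (J⁻¹ J_w J⁻¹ J_w)`. Rescaling `J` by `S = diag (1, u, v)` makes it regular
at `u = 0` with determinant `-1`. After the same rescaling `J_w` has a single singular entry, `U_w -
i U / u`, whence `u tr (...) = -1/u - 2i U_w / U + u R` with `R` continuous up to the axis
(`mul_trace_killing`).

On substitution the poles cancel and `F = 2ν - log |U| + 2 log v` satisfies `∂_w F = u · (bounded)`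
near each axis point (`wirtinger_log_axisRatio`). As `F` is real, its whole differential is `O(u)`,
so `F` tends to one and the same limit at all nearby axis points (`exists_tendsto_of_fderiv_bound`).
Now `e^(-F) = |U| / (v² e^(2ν))` and `U ≠ 0` keeps its sign, so the ratio is locally constant, hence
constant on the connected segment. -/

/-! ### The Wirtinger functional -/

/-- The Wirtinger derivative `∂_w = (∂_v - i ∂_u) / 2`, where `w = v + i u`, as a functional of
the differential of a real function of `(u, v)`. -/
def wirtinger (L : ℝ × ℝ →L[ℝ] ℝ) : ℂ :=
  (((L (0, 1) : ℝ) : ℂ) - Complex.I * ((L (1, 0) : ℝ) : ℂ)) / 2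

lemma wirtinger_add (L M : ℝ × ℝ →L[ℝ] ℝ) : wirtinger (L + M) = wirtinger L + wirtinger M := by
  simp [wirtinger]; ring

lemma wirtinger_sub (L M : ℝ × ℝ →L[ℝ] ℝ) : wirtinger (L - M) = wirtinger L - wirtinger M := by
  simp [wirtinger]; ring

lemma wirtinger_smul (c : ℝ) (L : ℝ × ℝ →L[ℝ] ℝ) : wirtinger (c • L) = c * wirtinger L := by
  simp [wirtinger]; ring

lemma wirtinger_fst : wirtinger (ContinuousLinearMap.fst ℝ ℝ ℝ) = -Complex.I / 2 := by
  simp [wirtinger]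

lemma wirtinger_snd : wirtinger (ContinuousLinearMap.snd ℝ ℝ ℝ) = 1 / 2 := by
  simp [wirtinger]

lemma continuous_wirtinger : Continuous wirtinger := by
  unfold wirtinger
  fun_prop

/-- For a real differential the real and imaginary parts of `∂_w` are, up to a factor of modulus
`1/2`, the two partial derivatives, so nothing is lost in the complex form. -/
lemma norm_le_of_wirtinger (L : ℝ × ℝ →L[ℝ] ℝ) : ‖L‖ ≤ 4 * ‖wirtinger L‖ := by
  have hre : |L (0, 1)| ≤ 2 * ‖wirtinger L‖ := by
    have h := Complex.abs_re_le_norm (wirtinger L)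
    have e : (wirtinger L).re = L (0, 1) / 2 := by simp [wirtinger]
    rw [e, abs_div, abs_two] at h
    linarith
  have him : |L (1, 0)| ≤ 2 * ‖wirtinger L‖ := by
    have h := Complex.abs_im_le_norm (wirtinger L)
    have e : (wirtinger L).im = -L (1, 0) / 2 := by simp [wirtinger]
    rw [e, abs_div, abs_two, abs_neg] at h
    linarith
  refine L.opNorm_le_bound (by positivity) fun x => ?_
  have hx : L x = x.1 * L (1, 0) + x.2 * L (0, 1) := by
    have : x = x.1 • ((1 : ℝ), (0 : ℝ)) + x.2 • ((0 : ℝ), (1 : ℝ)) := by ext <;> simp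
    conv_lhs => rw [this]
    simp only [map_add, map_smul, smul_eq_mul]
  have h1 : |x.1| ≤ ‖x‖ := norm_fst_le x
  have h2 : |x.2| ≤ ‖x‖ := norm_snd_le x
  rw [hx, Real.norm_eq_abs]
  calc |x.1 * L (1, 0) + x.2 * L (0, 1)|
      ≤ |x.1| * |L (1, 0)| + |x.2| * |L (0, 1)| := by
        rw [← abs_mul, ← abs_mul]; exact abs_add_le _ _
    _ ≤ ‖x‖ * (2 * ‖wirtinger L‖) + ‖x‖ * (2 * ‖wirtinger L‖) := by gcongr
    _ = 4 * ‖wirtinger L‖ * ‖x‖ := by ring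

lemma hasFDerivAt_weylPoint (p : ℝ × ℝ) :
    HasFDerivAt weylPoint
      ((p.1 • ContinuousLinearMap.snd ℝ ℝ ℝ + p.2 • ContinuousLinearMap.fst ℝ ℝ ℝ).prod
        (p.2 • ContinuousLinearMap.snd ℝ ℝ ℝ - p.1 • ContinuousLinearMap.fst ℝ ℝ ℝ)) p := by
  have h1 : HasFDerivAt (fun p : ℝ × ℝ => p.1) (ContinuousLinearMap.fst ℝ ℝ ℝ) p := hasFDerivAt_fst
  have h2 : HasFDerivAt (fun p : ℝ × ℝ => p.2) (ContinuousLinearMap.snd ℝ ℝ ℝ) p := hasFDerivAt_snd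
  refine (h1.mul h2).prodMk ?_
  have h3 := (((h2.pow 2).sub (h1.pow 2)).mul_const (1 / 2 : ℝ))
  refine (h3.congr_fderiv ?_).congr_of_eventuallyEq (Eventually.of_forall fun q => ?_)
  · ext <;> simp
  · simp; ring

/-- Chain rule for `ξ = w² / 2`, with `dξ/dw = w`. -/
lemma mul_dXi_weylPoint {f : ℝ × ℝ → ℝ} {p : ℝ × ℝ} (hf : DifferentiableAt ℝ f (weylPoint p)) :
    ((p.2 : ℂ) + Complex.I * p.1) * dXi f (weylPoint p) =
      wirtinger (fderiv ℝ (fun p => f (weylPoint p)) p) := by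
  set q := weylPoint p
  have hz : HasDerivAt (fun z => f (q.1, z)) (fderiv ℝ f q (0, 1)) q.2 := by
    have : HasFDerivAt f (fderiv ℝ f q) (q.1, q.2) := hf.hasFDerivAt
    exact this.comp_hasDerivAt q.2 ((hasDerivAt_const q.2 q.1).prodMk (hasDerivAt_id q.2))
  have hr : HasDerivAt (fun r => f (r, q.2)) (fderiv ℝ f q (1, 0)) q.1 := by
    have : HasFDerivAt f (fderiv ℝ f q) (q.1, q.2) := hf.hasFDerivAt
    exact this.comp_hasDerivAt q.1 ((hasDerivAt_id q.1).prodMk (hasDerivAt_const q.1 q.2))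
  have hc : HasFDerivAt (fun p => f (weylPoint p)) _ p :=
    hf.hasFDerivAt.comp p (hasFDerivAt_weylPoint p)
  have hx : ∀ a b : ℝ, fderiv ℝ f q (a, b) = a * fderiv ℝ f q (1, 0) + b * fderiv ℝ f q (0, 1) := by
    intro a b
    have : (a, b) = a • ((1 : ℝ), (0 : ℝ)) + b • ((0 : ℝ), (1 : ℝ)) := by ext <;> simp
    rw [this]
    simp only [map_add, map_smul, smul_eq_mul]
  rw [dXi, hz.deriv, hr.deriv, hc.fderiv, wirtinger]
  simp only [ContinuousLinearMap.comp_apply, ContinuousLinearMap.prod_apply,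
    add_apply, sub_apply, smul_apply,
    ContinuousLinearMap.coe_fst', ContinuousLinearMap.coe_snd', smul_eq_mul, mul_one, mul_zero,
    add_zero, zero_add, sub_zero, zero_sub]
  change _ = (((fderiv ℝ f q (p.1, p.2) : ℝ) : ℂ)
    - Complex.I * ((fderiv ℝ f q (p.2, -p.1) : ℝ) : ℂ)) / 2
  rw [hx p.1, hx p.2]
  push_cast
  linear_combination (-(p.1 : ℂ) * (fderiv ℝ f q (1, 0) : ℝ) / 2) * Complex.I_sq

lemma wirtinger_fderiv_fst_sq_mul {f : ℝ × ℝ → ℝ} {p : ℝ × ℝ} (hf : DifferentiableAt ℝ f p) :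
    wirtinger (fderiv ℝ (fun p => p.1 ^ 2 * f p) p) =
      p.1 ^ 2 * wirtinger (fderiv ℝ f p) - Complex.I * p.1 * f p := by
  have h1 : HasFDerivAt (fun p : ℝ × ℝ => p.1) (ContinuousLinearMap.fst ℝ ℝ ℝ) p := hasFDerivAt_fst
  have h : HasFDerivAt (fun p => p.1 ^ 2 * f p) _ p := (h1.pow 2).mul hf.hasFDerivAt
  rw [h.fderiv, wirtinger_add, wirtinger_smul, wirtinger_smul]
  simp [wirtinger_smul, wirtinger_fst]
  ring

lemma wirtinger_fderiv_snd_sq_mul {f : ℝ × ℝ → ℝ} {p : ℝ × ℝ} (hf : DifferentiableAt ℝ f p) :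
    wirtinger (fderiv ℝ (fun p => p.2 ^ 2 * f p) p) =
      p.2 ^ 2 * wirtinger (fderiv ℝ f p) + p.2 * f p := by
  have h1 : HasFDerivAt (fun p : ℝ × ℝ => p.2) (ContinuousLinearMap.snd ℝ ℝ ℝ) p := hasFDerivAt_snd
  have h : HasFDerivAt (fun p => p.2 ^ 2 * f p) _ p := (h1.pow 2).mul hf.hasFDerivAt
  rw [h.fderiv, wirtinger_add, wirtinger_smul, wirtinger_smul]
  simp [wirtinger_smul, wirtinger_snd]
  ring

/-! ### Algebra of the Killing matrix near the axis -/

/-- The inverse of `S⁻¹ J S⁻¹`, where `S = diag (1, u, v)` and `J` is the Killing matrix. -/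
def reducedInv (u v X Y Z U V W : ℂ) : Matrix (Fin 3) (Fin 3) ℂ :=
  !![-(U * W - u ^ 2 * v ^ 2 * V ^ 2), u * (Y * W - v ^ 2 * V * Z), v * (U * Z - u ^ 2 * Y * V);
     u * (Y * W - v ^ 2 * V * Z), -(X * W - v ^ 2 * Z ^ 2), u * (v * (X * V - Y * Z));
     v * (U * Z - u ^ 2 * Y * V), u * (v * (X * V - Y * Z)), -(X * U - u ^ 2 * Y ^ 2)]

/-- The matrix `S⁻¹ J_w S⁻¹` with its middle entry, the only one that is singular at `u = 0`,
replaced by `n`. -/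
def reducedDeriv (u v Y Z V W X' Y' Z' V' W' n : ℂ) : Matrix (Fin 3) (Fin 3) ℂ :=
  !![X', u * Y' - Complex.I * Y, v * Z' + Z;
     u * Y' - Complex.I * Y, n, u * v * V' + (u - Complex.I * v) * V;
     v * Z' + Z, u * v * V' + (u - Complex.I * v) * V, W' + W / v]

/-- The remainder `R` in `u tr (J⁻¹ J_w J⁻¹ J_w) = -1 / u - 2 i U_w / U + u R`. -/
def axisRemainder (u v X Y Z U V W X' Y' Z' U' V' W' : ℂ) : ℂ :=
  let a := Y * W - v ^ 2 * V * Z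
  let b := v * (X * V - Y * Z)
  let d := a * Y + v * b * V
  let L := U' / U
  let P := reducedInv u v X Y Z U V W
  let N := reducedDeriv u v Y Z V W X' Y' Z' V' W' 0
  let e := u * (X' * a ^ 2 + (W' + W / v) * b ^ 2 + 2 * (v * Z' + Z) * a * b) -
    2 * (X * W - v ^ 2 * Z ^ 2) *
      ((u * Y' - Complex.I * Y) * a + (u * v * V' + (u - Complex.I * v) * V) * b)
  Matrix.trace (P * N * P * N) + 2 * (L * u - Complex.I) * U * e + L ^ 2 * (1 - u ^ 2 * d) ^ 2
    + (-2 * Complex.I * L * u - 1) * (-2 * d + u ^ 2 * d ^ 2)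

/-- The entries of the Killing matrix as complex numbers. -/
def killingMatrix (u v X Y Z U V W : ℂ) : Matrix (Fin 3) (Fin 3) ℂ :=
  !![X, u ^ 2 * Y, v ^ 2 * Z;
     u ^ 2 * Y, u ^ 2 * U, u ^ 2 * v ^ 2 * V;
     v ^ 2 * Z, u ^ 2 * v ^ 2 * V, v ^ 2 * W]

/-- The `w`-derivative of the Killing matrix. -/
def killingDeriv (u v Y Z U V W X' Y' Z' U' V' W' : ℂ) : Matrix (Fin 3) (Fin 3) ℂ :=
  !![X', u ^ 2 * Y' - Complex.I * u * Y, v ^ 2 * Z' + v * Z;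
     u ^ 2 * Y' - Complex.I * u * Y, u ^ 2 * U' - Complex.I * u * U,
       u ^ 2 * (v ^ 2 * V' + v * V) - Complex.I * u * (v ^ 2 * V);
     v ^ 2 * Z' + v * Z, u ^ 2 * (v ^ 2 * V' + v * V) - Complex.I * u * (v ^ 2 * V),
       v ^ 2 * W' + v * W]

/-- The determinant of `S⁻¹ J S⁻¹`, where `S = diag (1, u, v)` and `J` is the Killing matrix. -/
def reducedDet {R : Type*} [CommRing R] (u v X Y Z U V W : R) : R :=
  U * (X * W - v ^ 2 * Z ^ 2) + u ^ 2 * (2 * v ^ 2 * Y * Z * V - Y ^ 2 * W - v ^ 2 * X * V ^ 2)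

/-- As the reduced determinant is `-1`, `reducedInv` is minus the adjugate of `S⁻¹ J S⁻¹`. -/
lemma killingMatrix_inv {u v X Y Z U V W : ℂ} (hu : u ≠ 0) (hv : v ≠ 0)
    (hdet : reducedDet u v X Y Z U V W = -1) :
    (killingMatrix u v X Y Z U V W)⁻¹ = Matrix.diagonal ![1, u⁻¹, v⁻¹] *
      reducedInv u v X Y Z U V W * Matrix.diagonal ![1, u⁻¹, v⁻¹] := by
  apply Matrix.inv_eq_left_inv
  have hB : Matrix.diagonal ![1, u⁻¹, v⁻¹] * reducedInv u v X Y Z U V W *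
      Matrix.diagonal ![1, u⁻¹, v⁻¹] =
      !![-(U * W - u ^ 2 * v ^ 2 * V ^ 2), Y * W - v ^ 2 * V * Z, U * Z - u ^ 2 * Y * V;
        Y * W - v ^ 2 * V * Z, -(X * W - v ^ 2 * Z ^ 2) / u ^ 2, X * V - Y * Z;
        U * Z - u ^ 2 * Y * V, X * V - Y * Z, -(X * U - u ^ 2 * Y ^ 2) / v ^ 2] := by
    ext i j
    rw [Matrix.mul_diagonal, Matrix.diagonal_mul]
    fin_cases i <;> fin_cases j <;> simp [reducedInv] <;> field_simp
  rw [hB]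
  unfold reducedDet at hdet
  ext i j
  fin_cases i <;> fin_cases j <;>
    simp [killingMatrix, Matrix.mul_apply, Fin.sum_univ_three] <;> field_simp <;>
    first
    | linear_combination -hdet
    | ring

lemma killingDeriv_eq {u v : ℂ} (hu : u ≠ 0) (hv : v ≠ 0) (Y Z U V W X' Y' Z' U' V' W' : ℂ) :
    killingDeriv u v Y Z U V W X' Y' Z' U' V' W' = Matrix.diagonal ![1, u, v] *
      reducedDeriv u v Y Z V W X' Y' Z' V' W' (U' - Complex.I * U / u) *
        Matrix.diagonal ![1, u, v] := by
  ext i j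
  rw [Matrix.mul_diagonal, Matrix.diagonal_mul]
  fin_cases i <;> fin_cases j <;> simp [reducedDeriv, killingDeriv] <;> field_simp <;> ring

lemma trace_killing_eq_reduced {u v X Y Z U V W : ℂ} (hu : u ≠ 0) (hv : v ≠ 0)
    (hdet : reducedDet u v X Y Z U V W = -1) (X' Y' Z' U' V' W' : ℂ) :
    Matrix.trace ((killingMatrix u v X Y Z U V W)⁻¹ *
      killingDeriv u v Y Z U V W X' Y' Z' U' V' W' * (killingMatrix u v X Y Z U V W)⁻¹ *
      killingDeriv u v Y Z U V W X' Y' Z' U' V' W') =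
    Matrix.trace (reducedInv u v X Y Z U V W *
      reducedDeriv u v Y Z V W X' Y' Z' V' W' (U' - Complex.I * U / u) *
      reducedInv u v X Y Z U V W *
      reducedDeriv u v Y Z V W X' Y' Z' V' W' (U' - Complex.I * U / u)) := by
  rw [killingMatrix_inv hu hv hdet, killingDeriv_eq hu hv]
  set P := reducedInv u v X Y Z U V W
  set N := reducedDeriv u v Y Z V W X' Y' Z' V' W' (U' - Complex.I * U / u)
  set S := Matrix.diagonal ![1, u, v]
  set T := Matrix.diagonal ![1, u⁻¹, v⁻¹]
  have hTS : T * S = 1 := by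
    rw [Matrix.diagonal_mul_diagonal, ← Matrix.diagonal_one]
    congr 1
    ext i
    fin_cases i <;> simp [hu, hv]
  have hST : S * T = 1 := mul_eq_one_comm.mp hTS
  have : T * P * T * (S * N * S) * (T * P * T) * (S * N * S) =
      T * (P * (T * S) * N * (S * T) * P * (T * S) * N) * S := by noncomm_ring
  rw [this, hTS, hST, Matrix.trace_mul_comm, ← mul_assoc, hST]
  simp only [mul_one, one_mul]

/-- The trace is quadratic in the middle entry `n`; this separates the powers of the only entry that
blows up on the axis. -/
lemma trace_symm_sq_middle (p₁ p₂ p₃ p₄ p₅ p₆ n₁ n₂ n₃ n n₅ n₆ : ℂ) :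
    Matrix.trace (!![p₁, p₂, p₃; p₂, p₄, p₅; p₃, p₅, p₆] * !![n₁, n₂, n₃; n₂, n, n₅; n₃, n₅, n₆] *
      !![p₁, p₂, p₃; p₂, p₄, p₅; p₃, p₅, p₆] * !![n₁, n₂, n₃; n₂, n, n₅; n₃, n₅, n₆]) =
    Matrix.trace (!![p₁, p₂, p₃; p₂, p₄, p₅; p₃, p₅, p₆] * !![n₁, n₂, n₃; n₂, 0, n₅; n₃, n₅, n₆] *
      !![p₁, p₂, p₃; p₂, p₄, p₅; p₃, p₅, p₆] * !![n₁, n₂, n₃; n₂, 0, n₅; n₃, n₅, n₆]) +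
    2 * n * (n₁ * p₂ ^ 2 + n₆ * p₅ ^ 2 + 2 * n₃ * p₂ * p₅ + 2 * p₄ * (n₂ * p₂ + n₅ * p₅)) +
    (n * p₄) ^ 2 := by
  simp [Matrix.trace, Fin.sum_univ_three]
  ring

/-- The poles come from the square `(n p₄)²`, since `n p₄ = (U' / U - i / u) (1 - u² d)`. In the
term linear in `n`, both `p₂` and `p₅` carry a factor `u`, which absorbs the pole of `n`. -/
lemma mul_trace_killing {u v X Y Z U V W : ℂ} (hu : u ≠ 0) (hv : v ≠ 0) (hU : U ≠ 0)
    (hdet : reducedDet u v X Y Z U V W = -1) (X' Y' Z' U' V' W' : ℂ) :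
    u * Matrix.trace ((killingMatrix u v X Y Z U V W)⁻¹ *
      killingDeriv u v Y Z U V W X' Y' Z' U' V' W' * (killingMatrix u v X Y Z U V W)⁻¹ *
      killingDeriv u v Y Z U V W X' Y' Z' U' V' W') =
    -1 / u - 2 * Complex.I * (U' / U) +
      u * axisRemainder u v X Y Z U V W X' Y' Z' U' V' W' := by
  rw [trace_killing_eq_reduced hu hv hdet, reducedInv, reducedDeriv, trace_symm_sq_middle]
  -- Expansion of the reduced determinant along its middle row.
  have hP : -(X * W - v ^ 2 * Z ^ 2) =
      (1 - u ^ 2 * ((Y * W - v ^ 2 * V * Z) * Y + v * (v * (X * V - Y * Z)) * V)) / U := by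
    rw [eq_div_iff hU]
    unfold reducedDet at hdet
    linear_combination -hdet
  have hN : U' - Complex.I * U / u = U * (U' / U - Complex.I / u) := by field_simp
  have hsq : ((U' - Complex.I * U / u) * -(X * W - v ^ 2 * Z ^ 2)) ^ 2 =
      (((U' / U - Complex.I / u)) *
      (1 - u ^ 2 * ((Y * W - v ^ 2 * V * Z) * Y + v * (v * (X * V - Y * Z)) * V))) ^ 2 := by
    rw [hP, hN]; field_simp
  rw [hsq, hN, axisRemainder, reducedInv, reducedDeriv]
  generalize Matrix.trace (n := Fin 3) (R := ℂ) _ = t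
  generalize U' / U = L
  generalize (Y * W - v ^ 2 * V * Z) = a
  generalize v * (X * V - Y * Z) = b
  generalize a * Y + v * b * V = d
  generalize u * Y' - Complex.I * Y = n₂
  generalize u * v * V' + (u - Complex.I * v) * V = n₅
  generalize v * Z' + Z = n₃
  generalize W' + W / v = n₆
  generalize X * W - v ^ 2 * Z ^ 2 = k
  field_simp
  ring_nf
  simp only [Complex.I_sq]
  ring

/-! ### Limits and continuity at the axis -/

lemma neBot_nhdsWithin_pos_fst (v : ℝ) :
    (𝓝[{p : ℝ × ℝ | 0 < p.1}] ((0 : ℝ), v)).NeBot := by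
  have : Tendsto (fun t : ℝ => (t, v)) (𝓝[>] 0) (𝓝[{p : ℝ × ℝ | 0 < p.1}] ((0 : ℝ), v)) :=
    tendsto_nhdsWithin_iff.2 ⟨((by fun_prop : Continuous fun t : ℝ => (t, v)).tendsto 0).mono_left
      inf_le_left, eventually_mem_nhdsWithin⟩
  exact this.neBot

/-- A function on a half ball whose differential is `O(u)` has one and the same limit at all points
of the axis `u = 0`. -/
lemma exists_tendsto_of_fderiv_bound {F : ℝ × ℝ → ℝ} {v₀ δ C : ℝ}
    (hd : ∀ p ∈ Metric.ball ((0 : ℝ), v₀) δ, 0 < p.1 → DifferentiableAt ℝ F p)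
    (hC : ∀ p ∈ Metric.ball ((0 : ℝ), v₀) δ, 0 < p.1 → ‖fderiv ℝ F p‖ ≤ C * p.1) :
    ∃ l : ℝ, ∀ v, ((0 : ℝ), v) ∈ Metric.ball ((0 : ℝ), v₀) δ →
      Tendsto F (𝓝[{p | 0 < p.1}] ((0 : ℝ), v)) (𝓝 l) := by
  by_cases hδ : 0 < δ
  swap
  · refine ⟨0, fun v hv => ?_⟩
    rw [Metric.ball_eq_empty.2 (not_lt.1 hδ)] at hv
    exact hv.elim
  set B := Metric.ball ((0 : ℝ), v₀) δ with hB
  have hC0 : 0 ≤ C := by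
    have hp : (δ / 2, v₀) ∈ B := by
      simp [hB, Prod.dist_eq, abs_of_pos hδ, hδ]
    have := (norm_nonneg _).trans (hC _ hp (by simpa using hδ))
    by_contra h
    have := mul_neg_of_neg_of_pos (not_le.1 h) (half_pos hδ)
    simp at *
    linarith
  -- Mean value inequality on the convex slab of height `m`, where the differential is at most `C
  -- m`; two points of the ball are less than `2δ` apart.
  have hlip : ∀ p ∈ B, 0 < p.1 → ∀ q ∈ B, 0 < q.1 → ∀ m, p.1 ≤ m → q.1 ≤ m →
      dist (F p) (F q) ≤ C * m * (2 * δ) := by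
    intro p hp hp0 q hq hq0 m hpm hqm
    have hconv : Convex ℝ (B ∩ {p : ℝ × ℝ | 0 < p.1 ∧ p.1 ≤ m}) :=
      (convex_ball _ _).inter
        ((convex_Ioc (0 : ℝ) m).linear_preimage (LinearMap.fst ℝ ℝ ℝ))
    have h := hconv.norm_image_sub_le_of_norm_fderiv_le (𝕜 := ℝ) (f := F) (C := C * m)
      (fun x hx => hd x hx.1 hx.2.1)
      (fun x hx => (hC x hx.1 hx.2.1).trans (mul_le_mul_of_nonneg_left hx.2.2 hC0))
      ⟨hq, hq0, hqm⟩ ⟨hp, hp0, hpm⟩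
    rw [dist_eq_norm]
    refine h.trans (mul_le_mul_of_nonneg_left ?_ (mul_nonneg hC0 (hp0.le.trans hpm)))
    rw [← dist_eq_norm]
    have h1 := dist_triangle_right p q ((0 : ℝ), v₀)
    have h2 := Metric.mem_ball.1 hp
    have h3 := Metric.mem_ball.1 hq
    linarith
  -- The filter `u → 0` in the half ball, with no condition on `v`. It is coarser than the approach
  -- to any single axis point, so a limit along it serves all of them.
  set l := comap (fun p : ℝ × ℝ => p.1) (𝓝 0) ⊓ 𝓟 (B ∩ {p | 0 < p.1}) with hl
  have hle : ∀ v, ((0 : ℝ), v) ∈ B → 𝓝[{p | 0 < p.1}] ((0 : ℝ), v) ≤ l := by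
    intro v hv
    refine le_inf ?_ ?_
    · rw [← tendsto_iff_comap]
      exact (continuous_fst.tendsto ((0 : ℝ), v)).mono_left inf_le_left
    · rw [le_principal_iff]
      exact inter_mem (mem_nhdsWithin_of_mem_nhds (Metric.isOpen_ball.mem_nhds hv))
        self_mem_nhdsWithin
  have hl0 : l.NeBot := (neBot_nhdsWithin_pos_fst v₀).mono (hle v₀ (Metric.mem_ball_self hδ))
  have hcauchy : Cauchy (map F l) := by
    rw [Metric.cauchy_iff]
    refine ⟨inferInstance, fun ε hε => ?_⟩
    obtain ⟨m, hm0, hm⟩ : ∃ m : ℝ, 0 < m ∧ C * m * (2 * δ) < ε := by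
      -- `C + 1` rather than `C`, as `C` may be zero.
      refine ⟨ε / (2 * δ * (C + 1)), by positivity, ?_⟩
      have : C * (ε / (2 * δ * (C + 1))) * (2 * δ) = ε * (C / (C + 1)) := by
        field_simp
      rw [this]
      have : C / (C + 1) < 1 := by rw [div_lt_one (by linarith)]; linarith
      nlinarith
    refine ⟨F '' ({p | p.1 < m} ∩ (B ∩ {p | 0 < p.1})), image_mem_map ?_, ?_⟩
    · exact inter_mem (mem_inf_of_left ⟨Set.Iio m, Iio_mem_nhds hm0, fun _ h => h⟩)
        (mem_inf_of_right (mem_principal_self _))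
    · rintro _ ⟨p, hp, rfl⟩ _ ⟨q, hq, rfl⟩
      exact (hlip p hp.2.1 hp.2.2 q hq.2.1 hq.2.2 m (le_of_lt hp.1) (le_of_lt hq.1)).trans_lt hm
  obtain ⟨a, ha⟩ := CompleteSpace.complete hcauchy
  exact ⟨a, fun v hv => (show Tendsto F l (𝓝 a) from ha).mono_left (hle v hv)⟩

lemma continuousWithinAt_axisRemainder {s : Set (ℝ × ℝ)} {p : ℝ × ℝ}
    {u v X Y Z U V W X' Y' Z' U' V' W' : ℝ × ℝ → ℂ}
    (hu : ContinuousWithinAt u s p) (hv : ContinuousWithinAt v s p)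
    (hX : ContinuousWithinAt X s p) (hY : ContinuousWithinAt Y s p)
    (hZ : ContinuousWithinAt Z s p) (hU : ContinuousWithinAt U s p)
    (hV : ContinuousWithinAt V s p) (hW : ContinuousWithinAt W s p)
    (hX' : ContinuousWithinAt X' s p) (hY' : ContinuousWithinAt Y' s p)
    (hZ' : ContinuousWithinAt Z' s p) (hU' : ContinuousWithinAt U' s p)
    (hV' : ContinuousWithinAt V' s p) (hW' : ContinuousWithinAt W' s p)
    (hv0 : v p ≠ 0) (hU0 : U p ≠ 0) :
    ContinuousWithinAt (fun q => axisRemainder (u q) (v q) (X q) (Y q) (Z q) (U q) (V q) (W q)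
      (X' q) (Y' q) (Z' q) (U' q) (V' q) (W' q)) s p := by
  -- The reciprocals become atoms, continuous at `p` because the denominators do not vanish there.
  obtain ⟨Ui, hUi⟩ : ∃ Ui : ℝ × ℝ → ℂ, ∀ q, (U q)⁻¹ = Ui q := ⟨_, fun _ => rfl⟩
  obtain ⟨vi, hvi⟩ : ∃ vi : ℝ × ℝ → ℂ, ∀ q, (v q)⁻¹ = vi q := ⟨_, fun _ => rfl⟩
  have hUi' : ContinuousWithinAt Ui s p := (funext hUi) ▸ hU.inv₀ hU0
  have hvi' : ContinuousWithinAt vi s p := (funext hvi) ▸ hv.inv₀ hv0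
  have hP : ContinuousWithinAt (fun q => reducedInv (u q) (v q) (X q) (Y q) (Z q) (U q) (V q)
      (W q)) s p := by
    refine continuousWithinAt_pi.2 fun i => continuousWithinAt_pi.2 fun j => ?_
    fin_cases i <;> fin_cases j <;> simp [reducedInv] <;> fun_prop
  have hN : ContinuousWithinAt (fun q => reducedDeriv (u q) (v q) (Y q) (Z q) (V q)
      (W q) (X' q) (Y' q) (Z' q) (V' q) (W' q) 0) s p := by
    refine continuousWithinAt_pi.2 fun i => continuousWithinAt_pi.2 fun j => ?_
    fin_cases i <;> fin_cases j <;> simp [reducedDeriv, div_eq_mul_inv, hvi] <;>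
      fun_prop
  have hT : ContinuousWithinAt (fun q => Matrix.trace (reducedInv (u q) (v q) (X q) (Y q) (Z q)
      (U q) (V q) (W q) * reducedDeriv (u q) (v q) (Y q) (Z q) (V q)
      (W q) (X' q) (Y' q) (Z' q) (V' q) (W' q) 0 * reducedInv (u q) (v q) (X q) (Y q) (Z q)
      (U q) (V q) (W q) * reducedDeriv (u q) (v q) (Y q) (Z q) (V q)
      (W q) (X' q) (Y' q) (Z' q) (V' q) (W' q) 0)) s p :=
    (continuous_id.matrix_trace.continuousAt).comp_continuousWithinAt
      (((hP.mul hN).mul hP).mul hN)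
  dsimp only [axisRemainder]
  refine ((hT.add ?_).add ?_).add ?_ <;> simp only [div_eq_mul_inv, hUi, hvi] <;> fun_prop

/-! ### The Einstein equation in the coordinate `w` -/

lemma det_axisMatrix (X Y Z U V W : ℝ × ℝ → ℝ) (p : ℝ × ℝ) :
    (axisMatrix X Y Z U V W p).det = (p.1 * p.2) ^ 2 *
      reducedDet p.1 p.2 (X p) (Y p) (Z p) (U p) (V p) (W p) := by
  simp [axisMatrix, Matrix.det_fin_three, reducedDet]
  ring

lemma reducedDet_eq_neg_one {X Y Z U V W : ℝ × ℝ → ℝ} {p : ℝ × ℝ} (hu : 0 < p.1) (hv : 0 < p.2)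
    (hdet : (axisMatrix X Y Z U V W p).det = -(weylPoint p).1 ^ 2) :
    reducedDet p.1 p.2 (X p) (Y p) (Z p) (U p) (V p) (W p) = -1 := by
  rw [det_axisMatrix] at hdet
  have h : (p.1 * p.2) ^ 2 ≠ 0 := by positivity
  apply mul_left_cancel₀ h
  rw [hdet, weylPoint]
  ring

lemma map_ofReal_axisMatrix (X Y Z U V W : ℝ × ℝ → ℝ) (p : ℝ × ℝ) :
    (axisMatrix X Y Z U V W p).map Complex.ofReal =
      killingMatrix p.1 p.2 (X p) (Y p) (Z p) (U p) (V p) (W p) := by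
  ext i j
  fin_cases i <;> fin_cases j <;> simp [axisMatrix, killingMatrix]

lemma smul_dXiMatrix_weylPoint {J : ℝ × ℝ → Matrix (Fin 3) (Fin 3) ℝ} {X Y Z U V W : ℝ × ℝ → ℝ}
    {p : ℝ × ℝ} (hJd : ∀ i j, DifferentiableAt ℝ (fun q => J q i j) (weylPoint p))
    (hJ : ∀ᶠ q in 𝓝 p, J (weylPoint q) = axisMatrix X Y Z U V W q)
    (hY : DifferentiableAt ℝ Y p) (hZ : DifferentiableAt ℝ Z p)
    (hU : DifferentiableAt ℝ U p) (hV : DifferentiableAt ℝ V p) (hW : DifferentiableAt ℝ W p) :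
    ((p.2 : ℂ) + Complex.I * p.1) • dXiMatrix J (weylPoint p) =
      killingDeriv p.1 p.2 (Y p) (Z p) (U p) (V p) (W p) (wirtinger (fderiv ℝ X p))
        (wirtinger (fderiv ℝ Y p)) (wirtinger (fderiv ℝ Z p)) (wirtinger (fderiv ℝ U p))
        (wirtinger (fderiv ℝ V p)) (wirtinger (fderiv ℝ W p)) := by
  have key : ∀ i j, (((p.2 : ℂ) + Complex.I * p.1) • dXiMatrix J (weylPoint p)) i j =
      wirtinger (fderiv ℝ (fun q => axisMatrix X Y Z U V W q i j) p) := by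
    intro i j
    rw [Matrix.smul_apply, dXiMatrix, Matrix.of_apply, smul_eq_mul, mul_dXi_weylPoint (hJd i j)]
    congr 1
    exact Filter.EventuallyEq.fderiv_eq (hJ.mono fun q hq => congrFun (congrFun hq i) j)
  have hV' : wirtinger (fderiv ℝ (fun p => p.1 ^ 2 * p.2 ^ 2 * V p) p) =
      p.1 ^ 2 * (p.2 ^ 2 * wirtinger (fderiv ℝ V p) + p.2 * V p) -
        Complex.I * p.1 * (p.2 ^ 2 * V p) := by
    have h := wirtinger_fderiv_fst_sq_mul (f := fun p => p.2 ^ 2 * V p) (p := p) (by fun_prop)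
    rw [wirtinger_fderiv_snd_sq_mul hV] at h
    simp only [mul_assoc] at h ⊢
    rw [h]
    push_cast
    ring
  ext i j
  rw [key]
  fin_cases i <;> fin_cases j <;>
    simp only [axisMatrix, killingDeriv, Matrix.of_apply, Matrix.cons_val', Matrix.cons_val_zero,
      Matrix.cons_val_one, Matrix.cons_val, Fin.zero_eta, Fin.mk_one, Fin.reduceFinMk,
      Fin.isValue, wirtinger_fderiv_fst_sq_mul hY, wirtinger_fderiv_snd_sq_mul hZ,
      wirtinger_fderiv_fst_sq_mul hU, wirtinger_fderiv_snd_sq_mul hW, hV']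

/-- The quotient by `u` of the `w`-derivative of `2 ν - log |U₀| + 2 log v`. -/
def axisFactor (u v X Y Z U V W X' Y' Z' U' V' W' : ℂ) : ℂ :=
  (Complex.I / (2 * v) - Complex.I * (U' / U) +
    Complex.I * v * axisRemainder u v X Y Z U V W X' Y' Z' U' V' W' / 2) / (v + Complex.I * u)

/-- The pole from `log u` cancels that of the trace: `(i / 2u)(1 - v/w) = -1 / (2w)`. Adding `2 log
v` leaves `1/(2v) - 1/(2w) = i u / (2vw)`, and `(v/w) U_w / U = U_w / U - (i u / w) U_w / U`; every
remaining term has a factor `u`. -/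
lemma wirtinger_log_axisRatio {J : ℝ × ℝ → Matrix (Fin 3) (Fin 3) ℝ} {ν X Y Z U V W : ℝ × ℝ → ℝ}
    {p : ℝ × ℝ} (hu : 0 < p.1) (hv : 0 < p.2)
    (hJd : ∀ i j, DifferentiableAt ℝ (fun q => J q i j) (weylPoint p))
    (hνd : DifferentiableAt ℝ ν (weylPoint p))
    (hdet : (J (weylPoint p)).det = -(weylPoint p).1 ^ 2)
    (hE : ConformalFactorEq J ν (weylPoint p))
    (hJ : ∀ᶠ q in 𝓝 p, J (weylPoint q) = axisMatrix X Y Z U V W q)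
    (hY : DifferentiableAt ℝ Y p) (hZ : DifferentiableAt ℝ Z p)
    (hU : DifferentiableAt ℝ U p) (hV : DifferentiableAt ℝ V p) (hW : DifferentiableAt ℝ W p)
    (hU0 : U p ≠ 0) :
    DifferentiableAt ℝ (fun q => 2 * ν (weylPoint q) - Real.log (U q) + 2 * Real.log q.2) p ∧
    wirtinger (fderiv ℝ
      (fun q => 2 * ν (weylPoint q) - Real.log (U q) + 2 * Real.log q.2) p) =
      p.1 * axisFactor p.1 p.2 (X p) (Y p) (Z p) (U p) (V p) (W p) (wirtinger (fderiv ℝ X p))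
        (wirtinger (fderiv ℝ Y p)) (wirtinger (fderiv ℝ Z p)) (wirtinger (fderiv ℝ U p))
        (wirtinger (fderiv ℝ V p)) (wirtinger (fderiv ℝ W p)) := by
  have hw : (p.2 : ℂ) + Complex.I * p.1 ≠ 0 := by
    intro h
    have := congrArg Complex.re h
    simp at this
    exact hv.ne' this
  have huC : (p.1 : ℂ) ≠ 0 := by exact_mod_cast hu.ne'
  have hvC : (p.2 : ℂ) ≠ 0 := by exact_mod_cast hv.ne'
  have hUC : (U p : ℂ) ≠ 0 := by exact_mod_cast hU0
  rw [hJ.self_of_nhds] at hdet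
  have hred := reducedDet_eq_neg_one hu hv hdet
  have hredC : reducedDet (p.1 : ℂ) p.2 (X p) (Y p) (Z p) (U p) (V p) (W p) = -1 := by
    rw [reducedDet] at hred ⊢
    exact_mod_cast congrArg Complex.ofReal hred
  have hq : 0 < (weylPoint p).1 := mul_pos hu hv
  -- the Einstein equation in the coordinate `w`
  have hlogd : DifferentiableAt ℝ (fun q => Real.log (q.1 * Real.exp (2 * ν q))) (weylPoint p) := by
    refine DifferentiableAt.log ?_ (by positivity)
    fun_prop
  have hνw : HasFDerivAt (fun q => ν (weylPoint q)) (fderiv ℝ (fun q => ν (weylPoint q)) p) p :=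
    (hνd.comp p (hasFDerivAt_weylPoint p).differentiableAt).hasFDerivAt
  set N := fderiv ℝ (fun q => ν (weylPoint q)) p
  have h1 : HasFDerivAt (fun p : ℝ × ℝ => Real.log p.1)
    (p.1⁻¹ • ContinuousLinearMap.fst ℝ ℝ ℝ) p := hasFDerivAt_fst.log hu.ne'
  have h2 : HasFDerivAt (fun p : ℝ × ℝ => Real.log p.2)
    (p.2⁻¹ • ContinuousLinearMap.snd ℝ ℝ ℝ) p := hasFDerivAt_snd.log hv.ne'
  have hlhs := mul_dXi_weylPoint hlogd
  have hev : (fun q => Real.log ((weylPoint q).1 * Real.exp (2 * ν (weylPoint q)))) =ᶠ[𝓝 p]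
      fun q => Real.log q.1 + Real.log q.2 + 2 * ν (weylPoint q) := by
    filter_upwards [continuous_fst.continuousAt.eventually_ne hu.ne',
      continuous_snd.continuousAt.eventually_ne hv.ne'] with q hq1 hq2
    rw [weylPoint, Real.log_mul (mul_ne_zero hq1 hq2) (Real.exp_ne_zero _), Real.log_exp,
      Real.log_mul hq1 hq2]
  have hsum : HasFDerivAt (fun q : ℝ × ℝ => Real.log q.1 + Real.log q.2 + 2 * ν (weylPoint q))
      (p.1⁻¹ • ContinuousLinearMap.fst ℝ ℝ ℝ + p.2⁻¹ • ContinuousLinearMap.snd ℝ ℝ ℝ +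
        (2 : ℝ) • N) p := (h1.add h2).add (hνw.const_mul 2)
  rw [hev.fderiv_eq, hsum.fderiv, wirtinger_add, wirtinger_add, wirtinger_smul, wirtinger_smul,
    wirtinger_smul, wirtinger_fst, wirtinger_snd] at hlhs
  have hF : HasFDerivAt (fun q => 2 * ν (weylPoint q) - Real.log (U q) + 2 * Real.log q.2)
      ((2 : ℝ) • N - (U p)⁻¹ • fderiv ℝ U p +
        (2 : ℝ) • (p.2⁻¹ • ContinuousLinearMap.snd ℝ ℝ ℝ)) p :=
    ((hνw.const_mul 2).sub (hU.hasFDerivAt.log hU0)).add (h2.const_mul 2)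
  refine ⟨hF.differentiableAt, ?_⟩
  rw [hF.fderiv, wirtinger_add, wirtinger_sub, wirtinger_smul, wirtinger_smul, wirtinger_smul,
    wirtinger_smul, wirtinger_snd]
  have htr := mul_trace_killing huC hvC hUC hredC (wirtinger (fderiv ℝ X p))
        (wirtinger (fderiv ℝ Y p)) (wirtinger (fderiv ℝ Z p)) (wirtinger (fderiv ℝ U p))
        (wirtinger (fderiv ℝ V p)) (wirtinger (fderiv ℝ W p))
  rw [← smul_dXiMatrix_weylPoint hJd hJ hY hZ hU hV hW] at htr
  simp only [Matrix.mul_smul, Matrix.smul_mul, Matrix.trace_smul, smul_eq_mul] at htr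
  rw [ConformalFactorEq, hJ.self_of_nhds, map_ofReal_axisMatrix] at hE
  rw [hE] at hlhs
  have hr : ((weylPoint p).1 : ℂ) = p.1 * p.2 := by simp [weylPoint]
  rw [hr] at hlhs
  rw [axisFactor]
  push_cast at hlhs ⊢
  revert htr hlhs
  generalize axisRemainder _ _ _ _ _ _ _ _ _ _ _ _ _ _ = R
  generalize Matrix.trace (n := Fin 3) (R := ℂ) _ = t
  generalize wirtinger (fderiv ℝ U p) = U'
  generalize wirtinger N = n
  generalize (p.1 : ℂ) = u at *
  generalize (p.2 : ℂ) = v at *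
  generalize (U p : ℂ) = U₁ at *
  intro htr hlhs
  set w := v + Complex.I * u with hwdef
  -- Each of the two factors `J_ξ = J_w / w` contributes one `1 / w`.
  have ht : t = (-1 / u - 2 * Complex.I * (U' / U₁) + u * R) / (u * (w * w)) := by
    rw [eq_div_iff (mul_ne_zero huC (mul_ne_zero hw hw)), ← htr]
    ring
  have hn : 2 * n = w * (Complex.I * (u * v) / 2 * t) - u⁻¹ * (-Complex.I / 2) - v⁻¹ * (1 / 2) := by
    rw [hlhs]; ring
  rw [hn, ht]
  field_simp
  rw [hwdef]
  ring_nf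
  simp only [Complex.I_sq]
  ring

/-! ### Local constancy of the ratio near an axis point -/

lemma uniqueDiffOn_inter_nonneg_fst {Ω : Set (ℝ × ℝ)} (hΩ : IsOpen Ω) :
    UniqueDiffOn ℝ (Ω ∩ {p | 0 ≤ p.1}) := by
  have hc : Convex ℝ {p : ℝ × ℝ | 0 ≤ p.1} :=
    (convex_Ici (0 : ℝ)).linear_preimage (LinearMap.fst ℝ ℝ ℝ)
  have hne : (interior {p : ℝ × ℝ | 0 ≤ p.1}).Nonempty := by
    have ho : IsOpen {p : ℝ × ℝ | 0 < p.1} := isOpen_lt continuous_const continuous_fst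
    have hsub : {p : ℝ × ℝ | 0 < p.1} ⊆ {p : ℝ × ℝ | 0 ≤ p.1} := fun p (hp : 0 < p.1) => hp.le
    exact ⟨(1, 0), interior_maximal hsub ho (show (0 : ℝ) < 1 from one_pos)⟩
  rw [Set.inter_comm]
  exact (uniqueDiffOn_convex hc hne).inter hΩ

lemma continuousOn_wirtinger_fderivWithin {Ω : Set (ℝ × ℝ)} (hΩ : IsOpen Ω) {f : ℝ × ℝ → ℝ}
    (hf : ContDiffOn ℝ 1 f (Ω ∩ {p | 0 ≤ p.1})) :
    ContinuousOn (fun p => wirtinger (fderivWithin ℝ f (Ω ∩ {p | 0 ≤ p.1}) p))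
      (Ω ∩ {p | 0 ≤ p.1}) :=
  continuous_wirtinger.comp_continuousOn
    (hf.continuousOn_fderivWithin (uniqueDiffOn_inter_nonneg_fst hΩ) le_rfl)

lemma inter_nonneg_fst_mem_nhds {Ω : Set (ℝ × ℝ)} (hΩ : IsOpen Ω) {p : ℝ × ℝ} (hp : p ∈ Ω)
    (hu : 0 < p.1) : Ω ∩ {p | 0 ≤ p.1} ∈ 𝓝 p :=
  inter_mem (hΩ.mem_nhds hp)
    ((continuous_fst.continuousAt.eventually (lt_mem_nhds hu)).mono fun _ h => le_of_lt h)

lemma exists_tendsto_axisRatio_const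
    {Ω : Set (ℝ × ℝ)} (hΩo : IsOpen Ω) (hΩv : ∀ p ∈ Ω, 0 < p.2)
    {J : ℝ × ℝ → Matrix (Fin 3) (Fin 3) ℝ} {ν : ℝ × ℝ → ℝ}
    (hJd : ∀ p ∈ Ω, 0 < p.1 → ∀ i j, DifferentiableAt ℝ (fun q => J q i j) (weylPoint p))
    (hνd : ∀ p ∈ Ω, 0 < p.1 → DifferentiableAt ℝ ν (weylPoint p))
    (hdet : ∀ p ∈ Ω, 0 < p.1 → (J (weylPoint p)).det = -(weylPoint p).1 ^ 2)
    (hE : ∀ p ∈ Ω, 0 < p.1 → ConformalFactorEq J ν (weylPoint p))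
    {X Y Z U V W : ℝ × ℝ → ℝ}
    (hX : ContDiffOn ℝ 1 X (Ω ∩ {p | 0 ≤ p.1})) (hY : ContDiffOn ℝ 1 Y (Ω ∩ {p | 0 ≤ p.1}))
    (hZ : ContDiffOn ℝ 1 Z (Ω ∩ {p | 0 ≤ p.1})) (hU : ContDiffOn ℝ 1 U (Ω ∩ {p | 0 ≤ p.1}))
    (hV : ContDiffOn ℝ 1 V (Ω ∩ {p | 0 ≤ p.1})) (hW : ContDiffOn ℝ 1 W (Ω ∩ {p | 0 ≤ p.1}))
    (hJ : ∀ p ∈ Ω, 0 < p.1 → J (weylPoint p) = axisMatrix X Y Z U V W p)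
    {v₀ : ℝ} (hv₀ : ((0 : ℝ), v₀) ∈ Ω) :
    ∃ δ > 0, ∃ c : ℝ, c ≠ 0 ∧ ∀ v, dist v v₀ < δ → ∃ n : ℝ,
      Tendsto (fun p => ν (weylPoint p)) (𝓝[{p | 0 < p.1}] ((0 : ℝ), v)) (𝓝 n) ∧
        U (0, v) / (v ^ 2 * Real.exp (2 * n)) = c := by
  set D := Ω ∩ {p : ℝ × ℝ | 0 ≤ p.1} with hD
  have hmem : ∀ v, ((0 : ℝ), v) ∈ Ω → ((0 : ℝ), v) ∈ D := fun v hv => ⟨hv, le_refl (0 : ℝ)⟩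
  have hpos : ∀ v, ((0 : ℝ), v) ∈ Ω → 𝓝[{p | 0 < p.1}] ((0 : ℝ), v) ≤ 𝓝[D] ((0 : ℝ), v) := by
    intro v hv
    refine nhdsWithin_le_iff.2 (inter_mem (mem_nhdsWithin_of_mem_nhds (hΩo.mem_nhds hv)) ?_)
    filter_upwards [self_mem_nhdsWithin] with p hp using le_of_lt hp
  have hp₀ := hmem v₀ hv₀
  -- `U` does not vanish on the axis
  have hU0 : U (0, v₀) ≠ 0 := by
    have hc : ContinuousWithinAt (fun p : ℝ × ℝ => reducedDet p.1 p.2 (X p) (Y p) (Z p) (U p) (V p)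
        (W p)) D (0, v₀) := by
      have hX := hX.continuousOn _ hp₀
      have hY := hY.continuousOn _ hp₀
      have hZ := hZ.continuousOn _ hp₀
      have hU := hU.continuousOn _ hp₀
      have hV := hV.continuousOn _ hp₀
      have hW := hW.continuousOn _ hp₀
      unfold reducedDet
      fun_prop
    have hneg : (fun p : ℝ × ℝ => reducedDet p.1 p.2 (X p) (Y p) (Z p) (U p) (V p) (W p))
        =ᶠ[𝓝[{p | 0 < p.1}] ((0 : ℝ), v₀)] fun _ => -1 := by
      filter_upwards [self_mem_nhdsWithin, mem_nhdsWithin_of_mem_nhds (hΩo.mem_nhds hv₀)]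
        with p hu hp
      exact reducedDet_eq_neg_one hu (hΩv p hp) (hJ p hp hu ▸ hdet p hp hu)
    have := neBot_nhdsWithin_pos_fst v₀
    have h := tendsto_nhds_unique (hc.tendsto.mono_left (hpos v₀ hv₀))
      (tendsto_const_nhds.congr' hneg.symm)
    -- On the axis `reducedDet` is `U (X W - v² Z²)`, so `U = 0` would give `0 = -1`.
    intro h0
    simp [reducedDet, h0] at h
  -- the quotient of the derivative by `u` is bounded
  set R : ℝ × ℝ → ℂ := fun p => axisFactor p.1 p.2 (X p) (Y p) (Z p) (U p) (V p) (W p)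
    (wirtinger (fderivWithin ℝ X D p)) (wirtinger (fderivWithin ℝ Y D p))
    (wirtinger (fderivWithin ℝ Z D p)) (wirtinger (fderivWithin ℝ U D p))
    (wirtinger (fderivWithin ℝ V D p)) (wirtinger (fderivWithin ℝ W D p)) with hR
  have hRc : ContinuousWithinAt R D (0, v₀) := by
    have hre : ∀ {f : ℝ × ℝ → ℝ}, ContDiffOn ℝ 1 f D →
        ContinuousWithinAt (fun p => (f p : ℂ)) D (0, v₀) := fun hf =>
      Complex.continuous_ofReal.continuousAt.comp_continuousWithinAt (hf.continuousOn _ hp₀)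
    have hfst : ContinuousWithinAt (fun p : ℝ × ℝ => (p.1 : ℂ)) D (0, v₀) := by fun_prop
    have hsnd : ContinuousWithinAt (fun p : ℝ × ℝ => (p.2 : ℂ)) D (0, v₀) := by fun_prop
    have hvC : (v₀ : ℂ) ≠ 0 := by exact_mod_cast (hΩv _ hv₀).ne'
    have hUC : (U (0, v₀) : ℂ) ≠ 0 := by exact_mod_cast hU0
    have hd : ∀ {f : ℝ × ℝ → ℝ}, ContDiffOn ℝ 1 f D →
        ContinuousWithinAt (fun p => wirtinger (fderivWithin ℝ f D p)) D (0, v₀) := fun hf =>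
      continuousOn_wirtinger_fderivWithin hΩo hf _ hp₀
    have hrem := continuousWithinAt_axisRemainder hfst hsnd (hre hX) (hre hY) (hre hZ) (hre hU)
      (hre hV) (hre hW) (hd hX) (hd hY) (hd hZ) (hd hU) (hd hV) (hd hW) hvC hUC
    have hL := (hd hU).div (hre hU) hUC
    refine ContinuousWithinAt.div (((ContinuousWithinAt.div continuousWithinAt_const
      (continuousWithinAt_const.mul hsnd) (by simpa using hvC)).sub
      (continuousWithinAt_const.mul hL)).add
      (((continuousWithinAt_const.mul hsnd).mul hrem).div_const 2)) (by fun_prop) ?_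
    simpa using hvC
  -- Positivity of the product says that `U` keeps the sign of `U (0, v₀)`, on the axis as well as
  -- off it.
  have hloc : ∀ᶠ p in 𝓝 ((0 : ℝ), v₀), p ∈ Ω ∧
      (0 ≤ p.1 → ‖R p‖ < ‖R (0, v₀)‖ + 1 ∧ 0 < U p * U (0, v₀)) := by
    have h1 : ∀ᶠ p in 𝓝[D] ((0 : ℝ), v₀), ‖R p‖ < ‖R (0, v₀)‖ + 1 :=
      hRc.norm.eventually (gt_mem_nhds (lt_add_one _))
    have h2 : ∀ᶠ p in 𝓝[D] ((0 : ℝ), v₀), 0 < U p * U (0, v₀) :=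
      ((hU.continuousOn _ hp₀).mul continuousWithinAt_const).eventually
        (lt_mem_nhds (mul_self_pos.2 hU0))
    filter_upwards [hΩo.mem_nhds hv₀, eventually_nhdsWithin_iff.1 (h1.and h2)] with p hp h
    exact ⟨hp, fun h0 => h ⟨hp, h0⟩⟩
  obtain ⟨δ, hδ, hball⟩ := Metric.eventually_nhds_iff_ball.1 hloc
  set F : ℝ × ℝ → ℝ := fun q => 2 * ν (weylPoint q) - Real.log (U q) + 2 * Real.log q.2
  have hF : ∀ p ∈ Metric.ball ((0 : ℝ), v₀) δ, 0 < p.1 →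
      DifferentiableAt ℝ F p ∧ wirtinger (fderiv ℝ F p) = p.1 * R p := by
    intro p hpb hu
    obtain ⟨hp, h⟩ := hball p hpb
    have hn := inter_nonneg_fst_mem_nhds hΩo hp hu
    have hd : ∀ {f : ℝ × ℝ → ℝ}, ContDiffOn ℝ 1 f D → DifferentiableAt ℝ f p := fun hf =>
      (hf.differentiableOn one_ne_zero).differentiableAt hn
    have hJe : ∀ᶠ q in 𝓝 p, J (weylPoint q) = axisMatrix X Y Z U V W q := by
      filter_upwards [hΩo.mem_nhds hp, continuous_fst.continuousAt.eventually (lt_mem_nhds hu)]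
        with q hq hqu using hJ q hq hqu
    -- Off the axis the one-sided derivatives, which are continuous up to `u = 0`, are the ordinary
    -- ones.
    simp only [hR, fderivWithin_of_mem_nhds hn, hD]
    exact wirtinger_log_axisRatio hu (hΩv p hp) (hJd p hp hu) (hνd p hp hu) (hdet p hp hu)
      (hE p hp hu) hJe (hd hY) (hd hZ) (hd hU) (hd hV) (hd hW)
      (left_ne_zero_of_mul (h hu.le).2.ne')
  obtain ⟨l, hl⟩ := exists_tendsto_of_fderiv_bound (F := F) (C := 4 * (‖R (0, v₀)‖ + 1))
    (fun p hp hu => (hF p hp hu).1) (fun p hp hu => by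
      refine (norm_le_of_wirtinger _).trans ?_
      rw [(hF p hp hu).2, norm_mul, Complex.norm_real, Real.norm_of_nonneg hu.le]
      nlinarith [(((hball p hp).2 hu.le).1).le])
  -- `Real.log (U q)` is `log |U|`, so `F` determines only the absolute value of the ratio; the sign
  -- is restored here.
  refine ⟨δ, hδ, SignType.sign (U (0, v₀)) * Real.exp (-l), ?_, fun v hv => ?_⟩
  · rcases hU0.lt_or_gt with h | h <;> simp [h, sign_neg, sign_pos]
  have hvb : ((0 : ℝ), v) ∈ Metric.ball ((0 : ℝ), v₀) δ := by
    simpa [Prod.dist_eq, hδ] using hv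
  obtain ⟨hvΩ, h⟩ := hball _ hvb
  have hUv := (h le_rfl).2
  have hUv0 : U (0, v) ≠ 0 := left_ne_zero_of_mul hUv.ne'
  have hv0 : 0 < v := hΩv _ hvΩ
  have hlogU : Tendsto (fun p => Real.log (U p)) (𝓝[{p | 0 < p.1}] ((0 : ℝ), v))
      (𝓝 (Real.log (U (0, v)))) :=
    ((hU.continuousOn _ (hmem v hvΩ)).tendsto.mono_left (hpos v hvΩ)).log hUv0
  have hlogv : Tendsto (fun p : ℝ × ℝ => Real.log p.2) (𝓝[{p | 0 < p.1}] ((0 : ℝ), v))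
      (𝓝 (Real.log v)) :=
    ((continuous_snd.tendsto ((0 : ℝ), v)).mono_left inf_le_left).log hv0.ne'
  refine ⟨(l + Real.log (U (0, v)) - 2 * Real.log v) / 2, ?_, ?_⟩
  · refine ((((hl v hvb).add hlogU).sub (hlogv.const_mul 2)).div_const 2).congr fun p => ?_
    simp only [F]
    ring
  · have he : Real.exp (2 * ((l + Real.log (U (0, v)) - 2 * Real.log v) / 2)) =
        Real.exp l * |U (0, v)| / v ^ 2 := by
      have : 2 * ((l + Real.log (U (0, v)) - 2 * Real.log v) / 2) =
        l + Real.log |U (0, v)| - Real.log (v ^ 2) := by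
          rw [Real.log_abs, Real.log_pow]; push_cast; ring
      rw [this, Real.exp_sub, Real.exp_add, Real.exp_log (abs_pos.2 hUv0),
        Real.exp_log (by positivity)]
    have hs : U (0, v) / |U (0, v)| = SignType.sign (U (0, v₀)) := by
      rcases hU0.lt_or_gt with h0 | h0
      · have : U (0, v) < 0 := by nlinarith
        rw [abs_of_neg this, sign_neg h0]
        simp [div_neg, div_self hUv0]
      · have : 0 < U (0, v) := by nlinarith
        rw [abs_of_pos this, sign_pos h0]
        simp [div_self hUv0]
    rw [he, ← hs, Real.exp_neg]
    have := abs_pos.2 hUv0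
    field_simp

end

/-! ### Passage from local to global along the segment -/

theorem mainTheorem3
    (I : Set ℝ) (hIo : IsOpen I) (hIc : I.OrdConnected)
    (Ω : Set (ℝ × ℝ)) (hΩo : IsOpen Ω) (hΩv : ∀ p ∈ Ω, 0 < p.2)
    (hIΩ : ∀ v ∈ I, ((0 : ℝ), v) ∈ Ω)
    (J : ℝ × ℝ → Matrix (Fin 3) (Fin 3) ℝ) (ν : ℝ × ℝ → ℝ)
    (hJd : ∀ p ∈ Ω, 0 < p.1 → ∀ i j, DifferentiableAt ℝ (fun q => J q i j) (weylPoint p))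
    (hνd : ∀ p ∈ Ω, 0 < p.1 → DifferentiableAt ℝ ν (weylPoint p))
    (hdet : ∀ p ∈ Ω, 0 < p.1 → (J (weylPoint p)).det = -(weylPoint p).1 ^ 2)
    (hEinstein : ∀ p ∈ Ω, 0 < p.1 → ConformalFactorEq J ν (weylPoint p))
    (X₀ Y₀ Z₀ U₀ V₀ W₀ : ℝ × ℝ → ℝ)
    (hX : ContDiffOn ℝ 1 X₀ (Ω ∩ {p | 0 ≤ p.1})) (hY : ContDiffOn ℝ 1 Y₀ (Ω ∩ {p | 0 ≤ p.1}))
    (hZ : ContDiffOn ℝ 1 Z₀ (Ω ∩ {p | 0 ≤ p.1})) (hU : ContDiffOn ℝ 1 U₀ (Ω ∩ {p | 0 ≤ p.1}))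
    (hV : ContDiffOn ℝ 1 V₀ (Ω ∩ {p | 0 ≤ p.1})) (hW : ContDiffOn ℝ 1 W₀ (Ω ∩ {p | 0 ≤ p.1}))
    (hJ : ∀ p ∈ Ω, 0 < p.1 → J (weylPoint p) = axisMatrix X₀ Y₀ Z₀ U₀ V₀ W₀ p) :
    ∃ ν₀ : ℝ → ℝ,
      (∀ v ∈ I, Tendsto (fun p => ν (weylPoint p)) (𝓝[{p | 0 < p.1}] ((0 : ℝ), v)) (𝓝 (ν₀ v))) ∧
      (∃ c : ℝ, c ≠ 0 ∧ ∀ v ∈ I, axisRatio U₀ ν₀ v = c) ∧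
      ((∃ v₁ ∈ I, axisRatio U₀ ν₀ v₁ = 1) → ∀ v ∈ I, axisRatio U₀ ν₀ v = 1) := by
  have hloc := fun v (hv : v ∈ I) => exists_tendsto_axisRatio_const hΩo hΩv hJd hνd hdet hEinstein
    hX hY hZ hU hV hW hJ (hIΩ v hv)
  choose! ν₀ hν₀ using fun v (hv : v ∈ I) =>
    show ∃ n, Tendsto (fun p => ν (weylPoint p)) (𝓝[{p | 0 < p.1}] ((0 : ℝ), v)) (𝓝 n) from by
      obtain ⟨δ, hδ, c, -, h⟩ := hloc v hv
      obtain ⟨n, hn, -⟩ := h v (by simpa using hδ)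
      exact ⟨n, hn⟩
  have hball : ∀ v ∈ I, ∃ δ > 0, ∃ c : ℝ, c ≠ 0 ∧ ∀ w ∈ I, dist w v < δ →
      axisRatio U₀ ν₀ w = c := by
    intro v hv
    obtain ⟨δ, hδ, c, hc, h⟩ := hloc v hv
    refine ⟨δ, hδ, c, hc, fun w hw hwv => ?_⟩
    obtain ⟨n, hn, hr⟩ := h w hwv
    have := neBot_nhdsWithin_pos_fst w
    -- Uniqueness of limits identifies the chosen `ν₀ w` with the local boundary value `n`.
    rw [axisRatio, tendsto_nhds_unique (hν₀ w hw) hn, hr]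
  have hconst : ∀ v ∈ I, ∀ w ∈ I, axisRatio U₀ ν₀ v = axisRatio U₀ ν₀ w := by
    intro v hv w hw
    -- Equality of the ratios is an equivalence relation that holds locally, hence everywhere on a
    -- connected set.
    refine hIc.isPreconnected.induction₂ (fun a b => axisRatio U₀ ν₀ a = axisRatio U₀ ν₀ b)
      (fun x hx => ?_) (fun _ _ _ _ _ _ => Eq.trans) (fun _ _ _ _ => Eq.symm) hv hw
    obtain ⟨δ, hδ, c, -, h⟩ := hball x hx
    filter_upwards [self_mem_nhdsWithin, mem_nhdsWithin_of_mem_nhds (Metric.ball_mem_nhds x hδ)]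
      with y hy hyx
    rw [h y hy hyx, h x hx (by simpa using hδ)]
  refine ⟨ν₀, hν₀, ?_, fun ⟨v₁, hv₁, h1⟩ v hv => (hconst v hv v₁ hv₁).trans h1⟩
  rcases I.eq_empty_or_nonempty with rfl | ⟨v₁, hv₁⟩
  -- On an empty segment any non-zero constant will do.
  · exact ⟨1, one_ne_zero, fun v hv => hv.elim⟩
  · obtain ⟨δ, hδ, c, hc, h⟩ := hball v₁ hv₁
    exact ⟨c, hc, fun v hv => (hconst v hv v₁ hv₁).trans (h v₁ hv₁ (by simpa using hδ))⟩
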